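/- Let $a\ge 2$ be an integer. For $b,c\in\mathbb N$ with $b+c>a$ let $C_{b,c}$ be the complex affine plane curve $f=x^a+y^a+x^by^c=0$, and let $\tau(b,c)=\dim_{\mathbb C}\mathbb C[x,y]_{(x,y)}/(f,f_x,f_y)$ be its Tjurina number at the origin $O$. Then for all $b,c\in\mathbb N$ with $b+c>a$ the curve $C_{b,c}$ has an ordinary singularity of multiplicity $a$ at $O$ (that is, $O$ is a point of multiplicity $a$ whose tangent cone consists of $a$ distinct lines), and $\tau(b,c)$ is finite. If moreover $b\ge c$, then the value of $\tau(b,c)$ is as follows, and the listed cases exhaust all possibilities: $$ \tau(b,c)=\begin{cases} (a-1)^2 & \text{if } b\ge a,\ \text{or } b=a-1 \text{ and } c\ge \frac a2,\\[2pt] b(a-1)+c(a+1)-bc-a+1 & \text{if } \frac{a+1}2<b\le a-1 \text{ and } c\le\frac{a-1}2,\\[2pt] b(a-1)+c(a+1)-bc-a & \text{if } \frac{a+1}2<b<a-1 \text{ and } c=\frac a2,\\[2pt] b(a-1)+c(a-1)-bc & \text{if } \frac{a+1}2\le b<a-1 \text{ and } \frac{a+1}2\le c<a-1. \end{cases} $$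 Furthermore $$\min\{\tau(b,c) : b,c\in\mathbb N,\ b+c>a\}=\left\lfloor\frac{3a^2-2a-4}{4}\right\rfloor .$$ Among the pairs with $b\ge c$ and $b+c>a$, this minimum is attained at $(b,c)=\left(\frac a2+1,\frac a2\right)$ if $a$ is even and at $(b,c)=\left(\frac{a+1}2,\frac{a+1}2\right)$ if $a$ is odd. If $a\ge 5$, it is attained at no other pair with $b\ge c$ and $b+c>a$; if $a\le 4$, it is attained at every such pair. -/

import Mathlib

open MvPolynomial

/-- The maximal ideal in `ℂ[x, y]` of the point `P` of the affine plane: the polynomials that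
vanish at `P`. -/
noncomputable def pointIdeal (P : Fin 2 → ℂ) : Ideal (MvPolynomial (Fin 2) ℂ) :=
  RingHom.ker (MvPolynomial.eval P)

instance pointIdeal_isPrime (P : Fin 2 → ℂ) : (pointIdeal P).IsPrime :=
  RingHom.ker_isPrime (MvPolynomial.eval P)

/-- The local ring `ℂ[x, y]_𝔪` of the affine plane at `P`. -/
abbrev LocalRingAt (P : Fin 2 → ℂ) : Type :=
  Localization.AtPrime (pointIdeal P)

/-- The affine Jacobian ideal `(f, f_x, f_y)` of the curve `f = 0`. -/
noncomputable def jacobianIdeal (f : MvPolynomial (Fin 2) ℂ) : Ideal (MvPolynomial (Fin 2) ℂ) :=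
  Ideal.span {f, pderiv 0 f, pderiv 1 f}

/-- The coordinate ring of the component at `P` of the Jacobian scheme of `f = 0`, that is
`ℂ[x, y]_𝔪 / (f, f_x, f_y)`. -/
abbrev TjurinaAlgebra (f : MvPolynomial (Fin 2) ℂ) (P : Fin 2 → ℂ) : Type :=
  LocalRingAt P ⧸ (jacobianIdeal f).map (algebraMap (MvPolynomial (Fin 2) ℂ) (LocalRingAt P))

/-- The Tjurina number at `P` of the curve `f = 0`: the length of the component at `P` of its
Jacobian scheme, that is the dimension over `ℂ` of its coordinate ring.
(It is meaningful when `Module.Finite ℂ (TjurinaAlgebra f P)` holds.) -/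
noncomputable def tjurinaNumber (f : MvPolynomial (Fin 2) ℂ) (P : Fin 2 → ℂ) : ℕ :=
  Module.finrank ℂ (TjurinaAlgebra f P)

/-- The degree `m` homogeneous part of the Taylor expansion of `f` at `P`. If `P` has
multiplicity `m` on the curve `f = 0`, this form is the equation of the tangent cone at `P`
(in coordinates centred at `P`). -/
noncomputable def taylorForm (f : MvPolynomial (Fin 2) ℂ) (P : Fin 2 → ℂ) (m : ℕ) :
    MvPolynomial (Fin 2) ℂ :=
  homogeneousComponent m (aeval (fun i => X i + C (P i)) f)

/-- `P` is an ordinary singularity of multiplicity `m` of the curve `f = 0`: it is a singular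
point, of multiplicity exactly `m`, and the tangent cone at `P` consists of `m` distinct lines
`u i * x + v i * y = 0`. -/
structure IsOrdinarySingularity (f : MvPolynomial (Fin 2) ℂ) (P : Fin 2 → ℂ) (m : ℕ) :
    Prop where
  two_le : 2 ≤ m
  mem_pow : f ∈ pointIdeal P ^ m
  notMem_pow_succ : f ∉ pointIdeal P ^ (m + 1)
  tangentCone : ∃ u v : Fin m → ℂ, (∀ i j, i ≠ j → u i * v j ≠ u j * v i) ∧
    taylorForm f P m = ∏ i, (C (u i) * X 0 + C (v i) * X 1)

/-- The polynomial `x ^ a + y ^ a + x ^ b * y ^ c`, where `x = X 0` and `y = X 1`. -/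
noncomputable def curvePoly (a b c : ℕ) : MvPolynomial (Fin 2) ℂ :=
  X 0 ^ a + X 1 ^ a + X 0 ^ b * X 1 ^ c

/-! Put n = a - 1, β = b - 1, γ = c - 1. Since x f_x + y f_y - a f = (b + c - a) x^b y^c and b + c >
a, the Jacobian ideal contains x^b y^c.

Suppose c ≤ b < a. Then f_x and f_y are, up to scalars, x^n + p x^β y^(γ+1) and y^n + q x^(β+1) y^γ.
Multiplying the former by y^(γ+1) yields x^β y^(2γ+2) as well. The result is `binomialIdeal`, and
its four generators act as a confluent rewriting system with leading terms x^n, y^n, x^(β+1)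
y^(γ+1), x^β y^(2γ+2). Counting the monomials under this staircase gives τ = n² - (n - b)(n - c) -
max(n - 2c, 0) (`finrank_quotient_binomialIdeal`). The ideal is supported at the origin, so
localizing changes nothing (`quotientEquivLocal`).

If b ≥ a, then f_x is x^n times a unit of the local ring, the ideal becomes (x^n, y^n), and τ = n².
The case b < c follows by exchanging the coordinates.

The minimum is then elementary. In terms of u = a - 1 - b, d = b - c, s = b + c - a - 1, the
quantity 4τ minus four times the claimed minimum is visibly nonnegative, up to a correction by 1
settled by parity (`floor_le_tjurinaNumber_curvePoly`). -/

/-- The monomial `x ^ i * y ^ j`. -/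
noncomputable def xy (i j : ℕ) : MvPolynomial (Fin 2) ℂ := X 0 ^ i * X 1 ^ j

theorem xy_eq_monomial (i j : ℕ) :
    xy i j = monomial (Finsupp.single 0 i + Finsupp.single 1 j) 1 := by
  rw [xy, X_pow_eq_monomial, X_pow_eq_monomial, monomial_mul, one_mul]

theorem xy_mul_xy (i j k l : ℕ) : xy i j * xy k l = xy (i + k) (j + l) := by
  simp only [xy, pow_add]; ring

theorem monomial_one_eq_xy (m : Fin 2 →₀ ℕ) : monomial m (1 : ℂ) = xy (m 0) (m 1) := by
  have h : m = Finsupp.single 0 (m 0) + Finsupp.single 1 (m 1) := by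
    ext i
    fin_cases i <;> simp
  rw [xy_eq_monomial, ← h]

theorem linearIndependent_xy : LinearIndependent ℂ (fun s : ℕ × ℕ => xy s.1 s.2) := by
  have h := (basisMonomials (Fin 2) ℂ).linearIndependent.comp
    (fun s : ℕ × ℕ => Finsupp.single (0 : Fin 2) s.1 + Finsupp.single 1 s.2) (by
      rintro ⟨i, j⟩ ⟨k, l⟩ h
      have h0 := DFunLike.congr_fun h 0
      have h1 := DFunLike.congr_fun h 1
      simp at h0 h1
      simp [h0, h1])
  rw [coe_basisMonomials] at h
  have e : (fun s : ℕ × ℕ => xy s.1 s.2) = (fun s => monomial s (1 : ℂ)) ∘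
      fun s : ℕ × ℕ => Finsupp.single (0 : Fin 2) s.1 + Finsupp.single 1 s.2 := by
    funext s
    exact xy_eq_monomial s.1 s.2
  rw [e]
  exact h

/-! ### Normal forms modulo the binomial ideal. -/

/-- The ideal with generators `x ^ n + p x ^ β y ^ (γ + 1)`, `y ^ n + q x ^ (β + 1) y ^ γ`,
`x ^ (β + 1) y ^ (γ + 1)` and `x ^ β y ^ (2 γ + 2)`. -/
noncomputable def binomialIdeal (n β γ : ℕ) (p q : ℂ) : Ideal (MvPolynomial (Fin 2) ℂ) :=
  Ideal.span {xy n 0 + p • xy β (γ + 1), xy 0 n + q • xy (β + 1) γ,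
    xy (β + 1) (γ + 1), xy β (2 * γ + 2)}

/-- The exponents of the monomials that form a basis modulo `binomialIdeal n β γ p q`. -/
def standardExponents (n β γ : ℕ) : Finset (ℕ × ℕ) :=
  (Finset.range n ×ˢ Finset.range n).filter fun s =>
    ¬ (β + 1 ≤ s.1 ∧ γ + 1 ≤ s.2) ∧ ¬ (β ≤ s.1 ∧ 2 * γ + 2 ≤ s.2)

theorem mem_standardExponents {n β γ i j : ℕ} :
    (i, j) ∈ standardExponents n β γ ↔ (i < n ∧ j < n) ∧
      ¬ (β + 1 ≤ i ∧ γ + 1 ≤ j) ∧ ¬ (β ≤ i ∧ 2 * γ + 2 ≤ j) := by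
  simp [standardExponents]

/-- From the n × n square the generator x^(β+1) y^(γ+1) removes a rectangle; beyond it, x^β y^(2γ+2)
removes only part of the column i = β, which is empty when n ≤ 2γ + 2. -/
theorem card_standardExponents {n β γ : ℕ} (hβ : β < n) :
    (standardExponents n β γ).card + (n - (β + 1)) * (n - (γ + 1)) + (n - (2 * γ + 2)) = n * n := by
  classical
  have h : Finset.range n ×ˢ Finset.range n = (standardExponents n β γ ∪
      (Finset.Ico (β + 1) n ×ˢ Finset.Ico (γ + 1) n)) ∪ ({β} ×ˢ Finset.Ico (2 * γ + 2) n) := by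
    ext ⟨i, j⟩
    simp only [Finset.mem_union, mem_standardExponents, Finset.mem_product, Finset.mem_range,
      Finset.mem_Ico, Finset.mem_singleton]
    omega
  have h1 : Disjoint (standardExponents n β γ)
      (Finset.Ico (β + 1) n ×ˢ Finset.Ico (γ + 1) n) := by
    rw [Finset.disjoint_left]
    rintro ⟨i, j⟩
    simp only [mem_standardExponents, Finset.mem_product, Finset.mem_Ico]
    omega
  have h2 : Disjoint (standardExponents n β γ ∪ (Finset.Ico (β + 1) n ×ˢ Finset.Ico (γ + 1) n))
      ({β} ×ˢ Finset.Ico (2 * γ + 2) n) := by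
    rw [Finset.disjoint_left]
    rintro ⟨i, j⟩
    simp only [Finset.mem_union, mem_standardExponents, Finset.mem_product, Finset.mem_Ico,
      Finset.mem_singleton]
    omega
  have h3 := congrArg Finset.card h
  rw [Finset.card_union_of_disjoint h2, Finset.card_union_of_disjoint h1] at h3
  simpa using h3.symm

/-- The normal form of `x ^ i * y ^ j` modulo `binomialIdeal n β γ p q`. -/
noncomputable def normalMonomial (n β γ : ℕ) (p q : ℂ) (i j : ℕ) : MvPolynomial (Fin 2) ℂ :=
  if (β + 1 ≤ i ∧ γ + 1 ≤ j) ∨ (β ≤ i ∧ 2 * γ + 2 ≤ j) then 0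
  else if i < n ∧ j < n then xy i j
  else if i = n ∧ j + γ + 1 < n then (-p) • xy β (j + γ + 1)
  else if j = n ∧ i + β + 1 < n then (-q) • xy (i + β + 1) γ
  -- The only case needing two rewritings: x^i y^n becomes -q x^n y^γ, and then p q x^β y^(2γ+1).
  else if j = n ∧ i + β + 1 = n ∧ 2 * γ + 2 ≤ n then (p * q) • xy β (2 * γ + 1)
  else 0

/-- The normal form of a polynomial modulo `binomialIdeal n β γ p q`. -/
noncomputable def normalForm (n β γ : ℕ) (p q : ℂ) :
    MvPolynomial (Fin 2) ℂ →ₗ[ℂ] MvPolynomial (Fin 2) ℂ :=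
  (basisMonomials (Fin 2) ℂ).constr ℂ fun m => normalMonomial n β γ p q (m 0) (m 1)

theorem normalForm_xy (n β γ : ℕ) (p q : ℂ) (i j : ℕ) :
    normalForm n β γ p q (xy i j) = normalMonomial n β γ p q i j := by
  have h := (basisMonomials (Fin 2) ℂ).constr_basis ℂ
    (fun m => normalMonomial n β γ p q (m 0) (m 1)) (Finsupp.single 0 i + Finsupp.single 1 j)
  rw [coe_basisMonomials] at h
  rw [xy_eq_monomial, normalForm, h]
  simp

theorem span_xy : Submodule.span ℂ (Set.range fun s : ℕ × ℕ => xy s.1 s.2) = ⊤ := by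
  rw [eq_top_iff, ← (basisMonomials (Fin 2) ℂ).span_eq, Submodule.span_le]
  rintro _ ⟨m, rfl⟩
  rw [coe_basisMonomials]
  exact Submodule.subset_span ⟨(m 0, m 1), (monomial_one_eq_xy m).symm⟩

/-- This and its companion say that the normal form kills monomial multiples of the two binomials.
The bound n ≤ 2β stops the rewriting: x^β y^n becomes a multiple of x^(2β+1) y^γ, which is zero
because 2β + 1 > n. The alternative p = q = 0 serves the monomial ideal (x^n, y^n). -/
theorem normalMonomial_add_left {n β γ : ℕ} {p q : ℂ} (hβ : β < n) (hγ : γ ≤ β)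
    (h2 : n ≤ 2 * β ∨ p = 0 ∧ q = 0) (i j : ℕ) :
    normalMonomial n β γ p q (i + n) j +
      p • normalMonomial n β γ p q (i + β) (j + (γ + 1)) = 0 := by
  rcases h2 with h2 | ⟨rfl, rfl⟩
  · by_cases h : i = 0 ∧ j + γ + 1 < n ∧ j < γ + 1
    · obtain ⟨rfl, h⟩ := h
      have h3 : normalMonomial n β γ p q (0 + n) j = (-p) • xy β (j + γ + 1) := by
        unfold normalMonomial
        split_ifs <;> first | omega | rfl
      have h4 : normalMonomial n β γ p q (0 + β) (j + (γ + 1)) = xy β (j + γ + 1) := by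
        unfold normalMonomial
        rw [zero_add]
        split_ifs <;> first | omega | rfl
      rw [h3, h4, neg_smul, neg_add_cancel]
    · have h3 : normalMonomial n β γ p q (i + n) j = 0 := by
        unfold normalMonomial
        split_ifs <;> first | rfl | omega
      have h4 : normalMonomial n β γ p q (i + β) (j + (γ + 1)) = 0 := by
        unfold normalMonomial
        split_ifs <;> first | rfl | omega
      rw [h3, h4, smul_zero, add_zero]
  · simp [normalMonomial]

theorem normalMonomial_add_right {n β γ : ℕ} {p q : ℂ} (hβ : β < n) (hγ : γ ≤ β)
    (h2 : n ≤ 2 * β ∨ p = 0 ∧ q = 0) (i j : ℕ) :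
    normalMonomial n β γ p q i (j + n) +
      q • normalMonomial n β γ p q (i + (β + 1)) (j + γ) = 0 := by
  rcases h2 with h2 | ⟨rfl, rfl⟩
  · by_cases h : j = 0 ∧ i + β + 1 < n
    · obtain ⟨rfl, h⟩ := h
      have h3 : normalMonomial n β γ p q i (0 + n) = (-q) • xy (i + β + 1) γ := by
        unfold normalMonomial
        split_ifs <;> first | omega | rfl
      have h4 : normalMonomial n β γ p q (i + (β + 1)) (0 + γ) = xy (i + β + 1) γ := by
        unfold normalMonomial
        rw [zero_add]
        split_ifs <;> first | omega | rfl
      rw [h3, h4, neg_smul, neg_add_cancel]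
    -- The overlap of the two binomial rules: the second term contains x^n y^γ, which is itself
    -- reducible.
    · by_cases h' : j = 0 ∧ i + β + 1 = n ∧ 2 * γ + 2 ≤ n
      · obtain ⟨rfl, h', h''⟩ := h'
        have h3 : normalMonomial n β γ p q i (0 + n) = (p * q) • xy β (2 * γ + 1) := by
          unfold normalMonomial
          split_ifs <;> first | omega | rfl
        have h4 : normalMonomial n β γ p q (i + (β + 1)) (0 + γ) =
            (-p) • xy β (2 * γ + 1) := by
          unfold normalMonomial
          rw [show 0 + γ + γ + 1 = 2 * γ + 1 by ring]
          split_ifs <;> first | omega | rfl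
        rw [h3, h4, smul_smul, ← add_smul]
        ring_nf
        exact zero_smul _ _
      · have h3 : normalMonomial n β γ p q i (j + n) = 0 := by
          unfold normalMonomial
          split_ifs <;> first | rfl | omega
        have h4 : normalMonomial n β γ p q (i + (β + 1)) (j + γ) = 0 := by
          unfold normalMonomial
          split_ifs <;> first | rfl | omega
        rw [h3, h4, smul_zero, add_zero]
  · simp [normalMonomial]

theorem normalForm_eq_zero {n β γ : ℕ} {p q : ℂ} (hβ : β < n) (hγ : γ ≤ β)
    (h2 : n ≤ 2 * β ∨ p = 0 ∧ q = 0) {r : MvPolynomial (Fin 2) ℂ}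
    (hr : r ∈ binomialIdeal n β γ p q) : normalForm n β γ p q r = 0 := by
  -- The normal form is only ℂ-linear, so the multiplier must be built into the induction over the
  -- ideal; by linearity it may then be taken to be a monomial.
  suffices h : ∀ s, normalForm n β γ p q (s * r) = 0 by simpa using h 1
  rw [binomialIdeal, Ideal.span] at hr
  induction hr using Submodule.span_induction with
  | zero => simp
  | add u v _ _ hu hv => intro s; rw [mul_add, map_add, hu, hv, add_zero]
  | smul c u _ hu => intro s; rw [smul_eq_mul, ← mul_assoc, hu]
  | mem g hg =>
    intro s
    have hs : s ∈ Submodule.span ℂ (Set.range fun s : ℕ × ℕ => xy s.1 s.2) := by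
      rw [span_xy]; trivial
    induction hs using Submodule.span_induction with
    | zero => simp
    | add u v _ _ hu hv => rw [add_mul, map_add, hu, hv, add_zero]
    | smul c u _ hu => rw [smul_mul_assoc, map_smul, hu, smul_zero]
    | mem u hu =>
      obtain ⟨⟨i, j⟩, rfl⟩ := hu
      simp only [Set.mem_insert_iff, Set.mem_singleton_iff] at hg
      rcases hg with rfl | rfl | rfl | rfl
      · simp only [mul_add, mul_smul_comm, xy_mul_xy, map_add, map_smul, normalForm_xy]
        exact normalMonomial_add_left hβ hγ h2 i j
      · simp only [mul_add, mul_smul_comm, xy_mul_xy, map_add, map_smul, normalForm_xy]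
        exact normalMonomial_add_right hβ hγ h2 i j
      · simp only [xy_mul_xy, normalForm_xy]
        exact if_pos (by omega)
      · simp only [xy_mul_xy, normalForm_xy]
        exact if_pos (by omega)

/-! ### Every monomial is congruent to its normal form. -/

section Reduction

variable {n β γ : ℕ} {p q : ℂ}

theorem xy_mem_of_le {I : Ideal (MvPolynomial (Fin 2) ℂ)} {k l i j : ℕ} (h : xy k l ∈ I)
    (hi : k ≤ i) (hj : l ≤ j) : xy i j ∈ I := by
  have := I.mul_mem_left (xy (i - k) (j - l)) h
  rwa [xy_mul_xy, Nat.sub_add_cancel hi, Nat.sub_add_cancel hj] at this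

theorem xy_mem_binomialIdeal {i j : ℕ}
    (h : (β + 1 ≤ i ∧ γ + 1 ≤ j) ∨ (β ≤ i ∧ 2 * γ + 2 ≤ j)) :
    xy i j ∈ binomialIdeal n β γ p q := by
  rcases h with h | h
  · exact xy_mem_of_le (Ideal.subset_span (by simp)) h.1 h.2
  · exact xy_mem_of_le (Ideal.subset_span (by simp)) h.1 h.2

theorem xy_add_left_mem (i j : ℕ) :
    xy (i + n) j + p • xy (i + β) (j + (γ + 1)) ∈ binomialIdeal n β γ p q := by
  have h : xy n 0 + p • xy β (γ + 1) ∈ binomialIdeal n β γ p q := Ideal.subset_span (by simp)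
  have := (binomialIdeal n β γ p q).mul_mem_left (xy i j) h
  rwa [mul_add, mul_smul_comm, xy_mul_xy, xy_mul_xy] at this

theorem xy_add_right_mem (i j : ℕ) :
    xy i (j + n) + q • xy (i + (β + 1)) (j + γ) ∈ binomialIdeal n β γ p q := by
  have h : xy 0 n + q • xy (β + 1) γ ∈ binomialIdeal n β γ p q := Ideal.subset_span (by simp)
  have := (binomialIdeal n β γ p q).mul_mem_left (xy i j) h
  rwa [mul_add, mul_smul_comm, xy_mul_xy, xy_mul_xy] at this

/-- One rewriting of x^n leaves a spare factor x, which makes the result a multiple of x^(β+1)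
y^(γ+1). -/
theorem xy_mem_of_lt_left {i j : ℕ} (hi : n < i) : xy i j ∈ binomialIdeal n β γ p q := by
  obtain ⟨k, rfl⟩ := Nat.exists_eq_add_of_lt hi
  have h := xy_add_left_mem (n := n) (β := β) (γ := γ) (p := p) (q := q) (k + 1) j
  rw [show k + 1 + n = n + k + 1 by ring] at h
  exact (Ideal.add_mem_iff_left _ (Submodule.smul_of_tower_mem _ _
    (xy_mem_binomialIdeal (by omega)))).1 h

theorem xy_mem_of_lt_right {i j : ℕ} (hj : n < j) : xy i j ∈ binomialIdeal n β γ p q := by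
  obtain ⟨k, rfl⟩ := Nat.exists_eq_add_of_lt hj
  have h := xy_add_right_mem (n := n) (β := β) (γ := γ) (p := p) (q := q) i (k + 1)
  rw [show k + 1 + n = n + k + 1 by ring] at h
  exact (Ideal.add_mem_iff_left _ (Submodule.smul_of_tower_mem _ _
    (xy_mem_binomialIdeal (by omega)))).1 h

theorem xy_left_mem_of {j : ℕ} (h : xy β (j + (γ + 1)) ∈ binomialIdeal n β γ p q) :
    xy n j ∈ binomialIdeal n β γ p q := by
  have h' := xy_add_left_mem (n := n) (β := β) (γ := γ) (p := p) (q := q) 0 j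
  rw [zero_add, zero_add] at h'
  exact (Ideal.add_mem_iff_left _ (Submodule.smul_of_tower_mem _ _ h)).1 h'

theorem xy_right_mem_of {i : ℕ} (h : xy (i + (β + 1)) γ ∈ binomialIdeal n β γ p q) :
    xy i n ∈ binomialIdeal n β γ p q := by
  have h' := xy_add_right_mem (n := n) (β := β) (γ := γ) (p := p) (q := q) i 0
  rw [zero_add, zero_add] at h'
  exact (Ideal.add_mem_iff_left _ (Submodule.smul_of_tower_mem _ _ h)).1 h'

theorem xy_mem_of_normalMonomial_eq_zero (h2 : n ≤ 2 * β) {i j : ℕ} (h3 : n ≤ i ∨ n ≤ j)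
    (h4 : ¬ (i = n ∧ j + γ + 1 < n)) (h5 : ¬ (j = n ∧ i + β + 1 < n))
    (h6 : ¬ (j = n ∧ i + β + 1 = n ∧ 2 * γ + 2 ≤ n)) :
    xy i j ∈ binomialIdeal n β γ p q := by
  -- Rewriting y^n turns x^β y^n into a multiple of x^(2β+1) y^γ, where 2β + 1 > n.
  have aux : ∀ k, n ≤ k → xy β k ∈ binomialIdeal n β γ p q := fun k hk =>
    xy_mem_of_le (xy_right_mem_of (xy_mem_of_lt_left (by omega))) le_rfl hk
  by_cases hi : n < i
  · exact xy_mem_of_lt_left hi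
  by_cases hj : n < j
  · exact xy_mem_of_lt_right hj
  by_cases hi' : i = n
  · subst hi'
    exact xy_left_mem_of (aux _ (by omega))
  · obtain rfl : j = n := by omega
    apply xy_right_mem_of
    by_cases h : j < i + (β + 1)
    · exact xy_mem_of_lt_left h
    · rw [show i + (β + 1) = j by omega]
      exact xy_left_mem_of (aux _ (by omega))

theorem xy_sub_normalMonomial_mem (h2 : n ≤ 2 * β ∨ p = 0 ∧ q = 0) (i j : ℕ) :
    xy i j - normalMonomial n β γ p q i j ∈ binomialIdeal n β γ p q := by
  unfold normalMonomial
  split_ifs with h1 h3 h4 h5 h6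
  · rw [sub_zero]
    exact xy_mem_binomialIdeal h1
  · rw [sub_self]
    exact zero_mem _
  · have h := xy_add_left_mem (n := n) (β := β) (γ := γ) (p := p) (q := q) 0 j
    rw [zero_add, zero_add, ← add_assoc] at h
    rwa [h4.1, neg_smul, sub_neg_eq_add]
  · have h := xy_add_right_mem (n := n) (β := β) (γ := γ) (p := p) (q := q) i 0
    rw [zero_add, zero_add, ← add_assoc] at h
    rwa [h5.1, neg_smul, sub_neg_eq_add]
  · have h := xy_add_right_mem (n := n) (β := β) (γ := γ) (p := p) (q := q) i 0
    have h' := xy_add_left_mem (n := n) (β := β) (γ := γ) (p := p) (q := q) 0 γ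
    rw [zero_add, zero_add, ← add_assoc, h6.2.1] at h
    rw [zero_add, zero_add, show γ + (γ + 1) = 2 * γ + 1 by ring] at h'
    have := Ideal.sub_mem _ h (Submodule.smul_of_tower_mem _ q h')
    rw [h6.1]
    convert this using 1
    rw [smul_add, smul_smul, mul_comm p q]
    ring
  · rw [sub_zero]
    rcases h2 with h2 | ⟨rfl, rfl⟩
    · exact xy_mem_of_normalMonomial_eq_zero h2 (by omega) h4 h5 h6
    · rcases (by omega : n ≤ i ∨ n ≤ j) with h | h
      · have h' := xy_add_left_mem (n := n) (β := β) (γ := γ) (p := 0) (q := 0) 0 0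
        rw [zero_smul, add_zero, zero_add] at h'
        exact xy_mem_of_le h' h (Nat.zero_le _)
      · have h' := xy_add_right_mem (n := n) (β := β) (γ := γ) (p := 0) (q := 0) 0 0
        rw [zero_smul, add_zero, zero_add] at h'
        exact xy_mem_of_le h' (Nat.zero_le _) h

theorem normalMonomial_mem_span (hβ : β < n) (hγ : γ ≤ β) (i j : ℕ) :
    normalMonomial n β γ p q i j ∈
      Submodule.span ℂ ((fun s : ℕ × ℕ => xy s.1 s.2) '' standardExponents n β γ) := by
  have aux : ∀ k l, (k, l) ∈ standardExponents n β γ → xy k l ∈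
      Submodule.span ℂ ((fun s : ℕ × ℕ => xy s.1 s.2) '' standardExponents n β γ) :=
    fun k l h => Submodule.subset_span ⟨(k, l), h, rfl⟩
  unfold normalMonomial
  split_ifs with h1 h3 h4 h5 h6
  · exact zero_mem _
  · exact aux _ _ (mem_standardExponents.2 (by omega))
  · exact Submodule.smul_mem _ _ (aux _ _ (mem_standardExponents.2 (by omega)))
  · exact Submodule.smul_mem _ _ (aux _ _ (mem_standardExponents.2 (by omega)))
  · exact Submodule.smul_mem _ _ (aux _ _ (mem_standardExponents.2 (by omega)))
  · exact zero_mem _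

end Reduction

theorem normalMonomial_of_mem {n β γ : ℕ} {p q : ℂ} {i j : ℕ}
    (h : (i, j) ∈ standardExponents n β γ) : normalMonomial n β γ p q i j = xy i j := by
  rw [mem_standardExponents] at h
  rw [normalMonomial, if_neg (by omega), if_pos h.1]

/-- The standard monomials form a basis of the quotient by `binomialIdeal n β γ p q`. -/
noncomputable def binomialBasis {n β γ : ℕ} {p q : ℂ} (hβ : β < n) (hγ : γ ≤ β)
    (h2 : n ≤ 2 * β ∨ p = 0 ∧ q = 0) :
    Module.Basis (standardExponents n β γ) ℂ
      (MvPolynomial (Fin 2) ℂ ⧸ binomialIdeal n β γ p q) :=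
  Module.Basis.mk
    (v := fun s => Ideal.Quotient.mkₐ ℂ (binomialIdeal n β γ p q) (xy s.1.1 s.1.2))
    (by
      rw [linearIndependent_iff']
      intro t g hg
      have h1 : ∑ s ∈ t, g s • xy s.1.1 s.1.2 ∈ binomialIdeal n β γ p q := by
        rw [← Ideal.Quotient.eq_zero_iff_mem, ← Ideal.Quotient.mkₐ_eq_mk ℂ, map_sum, ← hg]
        exact Finset.sum_congr rfl fun s _ => map_smul _ _ _
      -- The normal form kills the combination as an element of the ideal, yet fixes each standard
      -- monomial, so the combination is already zero as a polynomial.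
      have h3 := normalForm_eq_zero hβ hγ h2 h1
      rw [map_sum] at h3
      have h4 : ∑ s ∈ t, g s • xy s.1.1 s.1.2 = 0 := by
        rw [← h3]
        refine Finset.sum_congr rfl fun s _ => ?_
        rw [map_smul, normalForm_xy, normalMonomial_of_mem s.2]
      exact linearIndependent_iff'.1
        (linearIndependent_xy.comp _ Subtype.val_injective) t g h4)
    (by
      have h1 : ⊤ ≤ Submodule.map (Ideal.Quotient.mkₐ ℂ (binomialIdeal n β γ p q)).toLinearMap
          (Submodule.span ℂ (Set.range fun s : ℕ × ℕ => xy s.1 s.2)) := by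
        rw [span_xy, Submodule.map_top, LinearMap.range_eq_top.2]
        exact Ideal.Quotient.mkₐ_surjective ℂ _
      refine h1.trans ?_
      rw [Submodule.map_span, Submodule.span_le]
      rintro _ ⟨_, ⟨⟨i, j⟩, rfl⟩, rfl⟩
      have h3 : Ideal.Quotient.mkₐ ℂ (binomialIdeal n β γ p q) (xy i j) =
          Ideal.Quotient.mkₐ ℂ _ (normalMonomial n β γ p q i j) :=
        Ideal.Quotient.eq.2 (xy_sub_normalMonomial_mem h2 i j)
      have h4 := Submodule.mem_map_of_mem
        (f := (Ideal.Quotient.mkₐ ℂ (binomialIdeal n β γ p q)).toLinearMap)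
        (normalMonomial_mem_span (p := p) (q := q) hβ hγ i j)
      rw [Submodule.map_span, ← Set.image_comp] at h4
      rw [AlgHom.toLinearMap_apply, h3]
      refine Submodule.span_mono ?_ h4
      rintro _ ⟨s, hs, rfl⟩
      exact ⟨⟨s, hs⟩, rfl⟩)

theorem finite_quotient_binomialIdeal {n β γ : ℕ} {p q : ℂ} (hβ : β < n) (hγ : γ ≤ β)
    (h2 : n ≤ 2 * β ∨ p = 0 ∧ q = 0) :
    Module.Finite ℂ (MvPolynomial (Fin 2) ℂ ⧸ binomialIdeal n β γ p q) :=
  Module.Finite.of_basis (binomialBasis hβ hγ h2)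

theorem finrank_quotient_binomialIdeal {n β γ : ℕ} {p q : ℂ} (hβ : β < n) (hγ : γ ≤ β)
    (h2 : n ≤ 2 * β ∨ p = 0 ∧ q = 0) :
    Module.finrank ℂ (MvPolynomial (Fin 2) ℂ ⧸ binomialIdeal n β γ p q) +
      (n - (β + 1)) * (n - (γ + 1)) + (n - (2 * γ + 2)) = n * n := by
  rw [Module.finrank_eq_card_basis (binomialBasis hβ hγ h2), Fintype.card_coe,
    card_standardExponents hβ]

/-! ### Passage to the local ring at a point. -/

theorem pointIdeal_zero : pointIdeal 0 = idealOfVars (Fin 2) ℂ := by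
  ext r
  rw [← pow_one (idealOfVars (Fin 2) ℂ), mem_pow_idealOfVars_iff', pointIdeal, RingHom.mem_ker,
    eval_zero, constantCoeff_eq]
  constructor
  · intro h x hx
    rw [Nat.lt_one_iff, Finsupp.degree_eq_zero_iff] at hx
    rwa [hx]
  · intro h
    exact h 0 (by simp)

theorem pointIdeal_zero_le {I : Ideal (MvPolynomial (Fin 2) ℂ)} (hx : X 0 ∈ I) (hy : X 1 ∈ I) :
    pointIdeal 0 ≤ I := by
  rw [pointIdeal_zero, idealOfVars, Ideal.span_le]
  rintro _ ⟨i, rfl⟩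
  fin_cases i
  · exact hx
  · exact hy

section Localization

variable {I : Ideal (MvPolynomial (Fin 2) ℂ)} {P : Fin 2 → ℂ}

/-- Modulo `I`, s is the nonzero constant s(P) plus a nilpotent. Hence localizing at `P` inverts
only elements that are already units in the quotient. -/
theorem isUnit_mk_of_notMem (hI : pointIdeal P ≤ I.radical) {s : MvPolynomial (Fin 2) ℂ}
    (hs : s ∉ pointIdeal P) : IsUnit (Ideal.Quotient.mk I s) := by
  have h1 : s - C (eval P s) ∈ pointIdeal P := by
    rw [pointIdeal, RingHom.mem_ker]
    simp
  obtain ⟨k, hk⟩ := hI h1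
  have h2 : IsNilpotent (Ideal.Quotient.mk I (s - C (eval P s))) :=
    ⟨k, by rw [← map_pow, Ideal.Quotient.eq_zero_iff_mem]; exact hk⟩
  have h3 : IsUnit (Ideal.Quotient.mk I (C (eval P s))) := by
    apply IsUnit.map
    apply IsUnit.map
    exact isUnit_iff_ne_zero.2 hs
  have h4 := h2.isUnit_add_left_of_commute h3 (Commute.all _ _)
  rwa [← map_add, add_sub_cancel] at h4

/-- The quotient of the plane's coordinate ring by an ideal whose radical contains the ideal of
the point `P` agrees with the quotient of the local ring at `P`. -/
noncomputable def quotientEquivLocal (hI : pointIdeal P ≤ I.radical) :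
    (MvPolynomial (Fin 2) ℂ ⧸ I) ≃ₐ[ℂ]
      (LocalRingAt P ⧸ I.map (algebraMap (MvPolynomial (Fin 2) ℂ) (LocalRingAt P))) :=
  AlgEquiv.ofBijective
    (Ideal.quotientMapₐ (I.map (algebraMap (MvPolynomial (Fin 2) ℂ) (LocalRingAt P)))
      (IsScalarTower.toAlgHom ℂ (MvPolynomial (Fin 2) ℂ) (LocalRingAt P)) Ideal.le_comap_map) (by
    constructor
    · rw [injective_iff_map_eq_zero]
      intro r hr
      obtain ⟨r, rfl⟩ := Ideal.Quotient.mk_surjective r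
      have h1 : algebraMap (MvPolynomial (Fin 2) ℂ) (LocalRingAt P) r ∈
        I.map (algebraMap (MvPolynomial (Fin 2) ℂ) (LocalRingAt P)) :=
          Ideal.Quotient.eq_zero_iff_mem.1 hr
      rw [IsLocalization.algebraMap_mem_map_algebraMap_iff (pointIdeal P).primeCompl] at h1
      obtain ⟨s, hs, h1⟩ := h1
      have h2 := isUnit_mk_of_notMem hI hs
      rw [← Ideal.Quotient.eq_zero_iff_mem, map_mul] at h1
      exact (h2.mul_right_eq_zero).1 h1
    · intro z
      obtain ⟨z, rfl⟩ := Ideal.Quotient.mk_surjective z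
      obtain ⟨r, s, rfl⟩ := IsLocalization.exists_mk'_eq (pointIdeal P).primeCompl z
      obtain ⟨t, ht⟩ := (isUnit_mk_of_notMem hI s.2).exists_right_inv
      obtain ⟨t, rfl⟩ := Ideal.Quotient.mk_surjective t
      refine ⟨Ideal.Quotient.mk I (r * t), ?_⟩
      rw [← map_mul, ← map_one (Ideal.Quotient.mk I), Ideal.Quotient.eq] at ht
      refine Ideal.Quotient.eq.2 ?_
      have h1 := Ideal.mem_map_of_mem (algebraMap (MvPolynomial (Fin 2) ℂ) (LocalRingAt P)) ht
      have h2 := Ideal.mul_mem_left _ (IsLocalization.mk' (LocalRingAt P) r s) h1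
      convert h2 using 1
      have h3 := IsLocalization.mk'_spec (LocalRingAt P) r s
      simp only [map_sub, map_mul, map_one, mul_sub, mul_one, ← mul_assoc]
      rw [h3]
      simp)

theorem finite_tjurinaAlgebra_and_tjurinaNumber_eq {f : MvPolynomial (Fin 2) ℂ}
    (hI : pointIdeal P ≤ I.radical)
    (hf : (jacobianIdeal f).map (algebraMap (MvPolynomial (Fin 2) ℂ) (LocalRingAt P)) =
      I.map (algebraMap (MvPolynomial (Fin 2) ℂ) (LocalRingAt P)))
    [Module.Finite ℂ (MvPolynomial (Fin 2) ℂ ⧸ I)] :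
    Module.Finite ℂ (TjurinaAlgebra f P) ∧
      tjurinaNumber f P = Module.finrank ℂ (MvPolynomial (Fin 2) ℂ ⧸ I) := by
  let e := ((quotientEquivLocal hI).trans
    (Ideal.quotientEquivAlgOfEq ℂ hf.symm)).toLinearEquiv
  exact ⟨Module.Finite.equiv e, e.finrank_eq.symm⟩

end Localization

/-! ### Symmetry under exchange of the coordinates. -/

theorem swap_curvePoly (a b c : ℕ) :
    renameEquiv ℂ (Equiv.swap (0 : Fin 2) 1) (curvePoly a b c) = curvePoly a c b := by
  simp [curvePoly]
  ring

theorem map_swap_pderiv (i : Fin 2) (f : MvPolynomial (Fin 2) ℂ) :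
    renameEquiv ℂ (Equiv.swap (0 : Fin 2) 1) (pderiv i f) =
      pderiv (Equiv.swap 0 1 i) (renameEquiv ℂ (Equiv.swap (0 : Fin 2) 1) f) :=
  (pderiv_rename (Equiv.injective _) i f).symm

theorem map_jacobianIdeal_swap (f : MvPolynomial (Fin 2) ℂ) :
    (jacobianIdeal f).map (renameEquiv ℂ (Equiv.swap (0 : Fin 2) 1) :
      MvPolynomial (Fin 2) ℂ →+* MvPolynomial (Fin 2) ℂ) =
      jacobianIdeal (renameEquiv ℂ (Equiv.swap (0 : Fin 2) 1) f) := by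
  rw [jacobianIdeal, Ideal.map_span, jacobianIdeal, Set.image_insert_eq, Set.image_pair,
    Set.pair_comm]
  simp only [RingHom.coe_coe, map_swap_pderiv]
  simp

/-- The isomorphism of the local ring at the origin that exchanges the coordinates. -/
noncomputable def localSwap : LocalRingAt 0 ≃ₐ[ℂ] LocalRingAt 0 :=
  IsLocalization.algEquivOfAlgEquiv (M := (pointIdeal 0).primeCompl)
    (T := (pointIdeal 0).primeCompl) (LocalRingAt 0) (LocalRingAt 0)
    (renameEquiv ℂ (Equiv.swap (0 : Fin 2) 1)) (by
      have h : ∀ r : MvPolynomial (Fin 2) ℂ,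
          renameEquiv ℂ (Equiv.swap (0 : Fin 2) 1) r ∈ pointIdeal 0 ↔ r ∈ pointIdeal 0 := by
        intro r
        simp [pointIdeal, RingHom.mem_ker]
      ext r
      constructor
      · rintro ⟨s, hs, rfl⟩
        exact fun h' => hs ((h s).1 h')
      · intro hr
        refine ⟨(renameEquiv ℂ (Equiv.swap (0 : Fin 2) 1)).symm r, fun h' => hr ?_, ?_⟩
        · rw [SetLike.mem_coe, ← h] at h'
          rwa [AlgEquiv.apply_symm_apply] at h'
        · exact AlgEquiv.apply_symm_apply _ _)

theorem localSwap_algebraMap (r : MvPolynomial (Fin 2) ℂ) :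
    localSwap (algebraMap _ (LocalRingAt 0) r) =
      algebraMap _ (LocalRingAt 0) (renameEquiv ℂ (Equiv.swap (0 : Fin 2) 1) r) :=
  IsLocalization.algEquivOfAlgEquiv_eq _ r

/-- Exchanging the coordinates does not change the Tjurina algebra at the origin. -/
noncomputable def tjurinaAlgebraSwap (f : MvPolynomial (Fin 2) ℂ) :
    TjurinaAlgebra f 0 ≃ₐ[ℂ]
      TjurinaAlgebra (renameEquiv ℂ (Equiv.swap (0 : Fin 2) 1) f) 0 :=
  Ideal.quotientEquivAlg _ _ localSwap (by
    rw [← map_jacobianIdeal_swap, Ideal.map_map, Ideal.map_map]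
    congr 1
    exact RingHom.ext fun r => (localSwap_algebraMap r).symm)

theorem tjurinaNumber_curvePoly_comm (a b c : ℕ) :
    tjurinaNumber (curvePoly a b c) 0 = tjurinaNumber (curvePoly a c b) 0 := by
  rw [← swap_curvePoly a b c]
  exact (tjurinaAlgebraSwap (curvePoly a b c)).toLinearEquiv.finrank_eq

theorem finite_tjurinaAlgebra_curvePoly_comm {a b c : ℕ}
    (h : Module.Finite ℂ (TjurinaAlgebra (curvePoly a b c) 0)) :
    Module.Finite ℂ (TjurinaAlgebra (curvePoly a c b) 0) := by
  rw [← swap_curvePoly a b c]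
  exact Module.Finite.equiv (tjurinaAlgebraSwap (curvePoly a b c)).toLinearEquiv

/-! ### The Jacobian ideal of the curve. -/

theorem pointIdeal_zero_le_radical_binomialIdeal (n β γ : ℕ) (p q : ℂ) :
    pointIdeal 0 ≤ (binomialIdeal n β γ p q).radical := by
  apply pointIdeal_zero_le
  · exact ⟨n + 1, by simpa [xy] using xy_mem_of_lt_left (i := n + 1) (j := 0) (by omega)⟩
  · exact ⟨n + 1, by simpa [xy] using xy_mem_of_lt_right (i := 0) (j := n + 1) (by omega)⟩

theorem curvePoly_eq_xy (a b c : ℕ) : curvePoly a b c = xy a 0 + xy 0 a + xy b c := by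
  simp [curvePoly, xy]

theorem pderiv_zero_xy (i j : ℕ) : pderiv 0 (xy i j) = (i : ℂ) • xy (i - 1) j := by
  simp [xy, smul_eq_C_mul]
  ring

theorem pderiv_one_xy (i j : ℕ) : pderiv 1 (xy i j) = (j : ℂ) • xy i (j - 1) := by
  simp [xy, smul_eq_C_mul]
  ring

theorem jacobianIdeal_curvePoly (n b c : ℕ) :
    jacobianIdeal (curvePoly (n + 1) b c) = Ideal.span {xy (n + 1) 0 + xy 0 (n + 1) + xy b c,
      ((n : ℂ) + 1) • xy n 0 + (b : ℂ) • xy (b - 1) c,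
      ((n : ℂ) + 1) • xy 0 n + (c : ℂ) • xy b (c - 1)} := by
  rw [jacobianIdeal, curvePoly_eq_xy]
  simp [pderiv_zero_xy, pderiv_one_xy]


theorem X_zero_mul_pderiv_xy (i j : ℕ) : X 0 * pderiv 0 (xy i j) = (i : ℂ) • xy i j := by
  rw [pderiv_zero_xy]
  rcases i with _ | i
  · simp
  · rw [mul_smul_comm, Nat.add_sub_cancel, xy, xy, pow_succ']
    ring_nf

theorem X_one_mul_pderiv_xy (i j : ℕ) : X 1 * pderiv 1 (xy i j) = (j : ℂ) • xy i j := by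
  rw [pderiv_one_xy]
  rcases j with _ | j
  · simp
  · rw [mul_smul_comm, Nat.add_sub_cancel, xy, xy, pow_succ']
    ring_nf

theorem smul_mem_iff_of_ne_zero {I : Ideal (MvPolynomial (Fin 2) ℂ)} {k : ℂ} (hk : k ≠ 0)
    {r : MvPolynomial (Fin 2) ℂ} : k • r ∈ I ↔ r ∈ I :=
  Submodule.smul_mem_iff (I.restrictScalars ℂ) hk

/-- By Euler's formula the Jacobian ideal contains the monomial of higher order. -/
theorem xy_mem_jacobianIdeal {a b c : ℕ} (h : a < b + c) :
    xy b c ∈ jacobianIdeal (curvePoly a b c) := by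
  have h0 : curvePoly a b c ∈ jacobianIdeal (curvePoly a b c) := Ideal.subset_span (by simp)
  have h1 : pderiv 0 (curvePoly a b c) ∈ jacobianIdeal (curvePoly a b c) :=
    Ideal.subset_span (by simp)
  have h2 : pderiv 1 (curvePoly a b c) ∈ jacobianIdeal (curvePoly a b c) :=
    Ideal.subset_span (by simp)
  have h3 := Ideal.sub_mem _ (Ideal.add_mem _ (Ideal.mul_mem_left _ (X 0) h1)
    (Ideal.mul_mem_left _ (X 1) h2)) (Submodule.smul_of_tower_mem _ (a : ℂ) h0)
  have h4 : X 0 * pderiv 0 (curvePoly a b c) + X 1 * pderiv 1 (curvePoly a b c) -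
      (a : ℂ) • curvePoly a b c = ((b : ℂ) + c - a) • xy b c := by
    simp only [curvePoly_eq_xy, map_add, mul_add, X_zero_mul_pderiv_xy, X_one_mul_pderiv_xy,
      smul_add, sub_smul, add_smul, Nat.cast_zero, zero_smul]
    abel
  rw [h4] at h3
  refine (smul_mem_iff_of_ne_zero ?_).1 h3
  rw [sub_ne_zero]
  exact_mod_cast h.ne'

/-- For b < a the equality holds already in the polynomial ring. Given Euler's monomial, f itself is
redundant, as x^(n+1) and y^(n+1) lie in the binomial ideal. -/
theorem jacobianIdeal_curvePoly_eq_binomialIdeal {n β γ : ℕ} (hβ : β < n)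
    (h : n < β + γ + 1) :
    jacobianIdeal (curvePoly (n + 1) (β + 1) (γ + 1)) =
      binomialIdeal n β γ ((β + 1) / (n + 1)) ((γ + 1) / (n + 1)) := by
  have hn : (n : ℂ) + 1 ≠ 0 := Nat.cast_add_one_ne_zero n
  have e1 : ((n : ℂ) + 1) • xy n 0 + (β + 1 : ℂ) • xy β (γ + 1) =
      ((n : ℂ) + 1) • (xy n 0 + ((β + 1 : ℂ) / (n + 1)) • xy β (γ + 1)) := by
    rw [smul_add, smul_smul, mul_div_cancel₀ _ hn]
  have e2 : ((n : ℂ) + 1) • xy 0 n + (γ + 1 : ℂ) • xy (β + 1) γ =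
      ((n : ℂ) + 1) • (xy 0 n + ((γ + 1 : ℂ) / (n + 1)) • xy (β + 1) γ) := by
    rw [smul_add, smul_smul, mul_div_cancel₀ _ hn]
  have h3 := xy_mem_jacobianIdeal (a := n + 1) (b := β + 1) (c := γ + 1) (by omega)
  apply le_antisymm
  · rw [jacobianIdeal_curvePoly, Ideal.span_le]
    simp only [Set.insert_subset_iff, Set.singleton_subset_iff, SetLike.mem_coe,
      Nat.add_sub_cancel, Nat.cast_add, Nat.cast_one, e1, e2, smul_mem_iff_of_ne_zero hn]
    refine ⟨Ideal.add_mem _ (Ideal.add_mem _ (xy_mem_of_lt_left (by omega))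
      (xy_mem_of_lt_right (by omega))) (xy_mem_binomialIdeal (by omega)), ?_, ?_⟩
    · exact Ideal.subset_span (by simp)
    · exact Ideal.subset_span (by simp)
  · have h1 : xy n 0 + ((β + 1 : ℂ) / (n + 1)) • xy β (γ + 1) ∈
        jacobianIdeal (curvePoly (n + 1) (β + 1) (γ + 1)) := by
      rw [← smul_mem_iff_of_ne_zero hn, ← e1, jacobianIdeal_curvePoly]
      exact Ideal.subset_span (by simp)
    have h2 : xy 0 n + ((γ + 1 : ℂ) / (n + 1)) • xy (β + 1) γ ∈
        jacobianIdeal (curvePoly (n + 1) (β + 1) (γ + 1)) := by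
      rw [← smul_mem_iff_of_ne_zero hn, ← e2, jacobianIdeal_curvePoly]
      exact Ideal.subset_span (by simp)
    rw [binomialIdeal, Ideal.span_le]
    simp only [Set.insert_subset_iff, Set.singleton_subset_iff, SetLike.mem_coe]
    refine ⟨h1, h2, h3, ?_⟩
    -- In y^(γ+1) (x^n + p x^β y^(γ+1)) the first term is a multiple of x^(β+1) y^(γ+1) because β <
    -- n, and p ≠ 0 may be cancelled.
    have h4 := Ideal.mul_mem_left _ (xy 0 (γ + 1)) h1
    rw [mul_add, mul_smul_comm, xy_mul_xy, xy_mul_xy, Ideal.add_mem_iff_right _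
      (xy_mem_of_le h3 (by omega) (by omega)), zero_add,
      show γ + 1 + (γ + 1) = 2 * γ + 2 by ring] at h4
    exact (smul_mem_iff_of_ne_zero (div_ne_zero (Nat.cast_add_one_ne_zero β) hn)).1 h4

/-- Here localization is essential: x^n divides f_x with a cofactor that is a unit only near the
origin. The choice β = γ = n - 1, p = q = 0 makes the binomial ideal equal to (x^n, y^n). -/
theorem map_jacobianIdeal_curvePoly_of_lt {n b c : ℕ} (hn : 0 < n) (hb : n < b)
    (h : n + 1 < b + c) :
    (jacobianIdeal (curvePoly (n + 1) b c)).map (algebraMap _ (LocalRingAt 0)) =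
      (binomialIdeal n (n - 1) (n - 1) 0 0).map (algebraMap _ (LocalRingAt 0)) := by
  have hn' : (n : ℂ) + 1 ≠ 0 := Nat.cast_add_one_ne_zero n
  have hx : xy n 0 ∈ binomialIdeal n (n - 1) (n - 1) 0 0 := Ideal.subset_span (by simp)
  have hy : xy 0 n ∈ binomialIdeal n (n - 1) (n - 1) 0 0 := Ideal.subset_span (by simp)
  apply le_antisymm
  · apply Ideal.map_mono
    rw [jacobianIdeal_curvePoly, Ideal.span_le]
    simp only [Set.insert_subset_iff, Set.singleton_subset_iff, SetLike.mem_coe]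
    refine ⟨Ideal.add_mem _ (Ideal.add_mem _ (xy_mem_of_le hx (by omega) le_rfl)
      (xy_mem_of_le hy le_rfl (by omega))) (xy_mem_of_le hx (by omega) (by omega)),
      Ideal.add_mem _ (Submodule.smul_of_tower_mem _ _ hx)
        (Submodule.smul_of_tower_mem _ _ (xy_mem_of_le hx (by omega) (by omega))),
      Ideal.add_mem _ (Submodule.smul_of_tower_mem _ _ hy)
        (Submodule.smul_of_tower_mem _ _ (xy_mem_of_le hx (by omega) (by omega)))⟩
  · rw [Ideal.map_le_iff_le_comap]
    set K := ((jacobianIdeal (curvePoly (n + 1) b c)).map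
      (algebraMap _ (LocalRingAt 0))).comap (algebraMap (MvPolynomial (Fin 2) ℂ) _) with hK
    have hJ : jacobianIdeal (curvePoly (n + 1) b c) ≤ K := Ideal.le_comap_map
    have hx' : xy n 0 ∈ K := by
      have h1 : ((n : ℂ) + 1) • xy n 0 + (b : ℂ) • xy (b - 1) c ∈ K := by
        apply hJ
        rw [jacobianIdeal_curvePoly]
        exact Ideal.subset_span (by simp)
      have e : ((n : ℂ) + 1) • xy n 0 + (b : ℂ) • xy (b - 1) c =
          (C ((n : ℂ) + 1) + C (b : ℂ) * xy (b - 1 - n) c) * xy n 0 := by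
        rw [add_mul, mul_assoc, xy_mul_xy, add_zero, Nat.sub_add_cancel (by omega),
          smul_eq_C_mul, smul_eq_C_mul]
      -- Since b + c > n + 1, the monomial is not constant, so the cofactor takes the value n + 1 at
      -- the origin.
      have hu : C ((n : ℂ) + 1) + C (b : ℂ) * xy (b - 1 - n) c ∈ (pointIdeal 0).primeCompl := by
        intro hu
        rw [SetLike.mem_coe, pointIdeal, RingHom.mem_ker] at hu
        have h0 : eval (0 : Fin 2 → ℂ) (xy (b - 1 - n) c) = 0 := by
          rcases (by omega : b - 1 - n ≠ 0 ∨ c ≠ 0) with h | h <;> simp [xy, h]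
        rw [map_add, map_mul, h0, mul_zero, add_zero, eval_C] at hu
        exact hn' hu
      rw [e, hK, Ideal.mem_comap, map_mul] at h1
      exact (Ideal.unit_mul_mem_iff_mem _
        (IsLocalization.map_units (LocalRingAt 0) (⟨_, hu⟩ : (pointIdeal 0).primeCompl))).1 h1
    have hy' : xy 0 n ∈ K := by
      have h1 : ((n : ℂ) + 1) • xy 0 n + (c : ℂ) • xy b (c - 1) ∈ K := by
        apply hJ
        rw [jacobianIdeal_curvePoly]
        exact Ideal.subset_span (by simp)
      rwa [Ideal.add_mem_iff_left _ (Submodule.smul_of_tower_mem _ _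
        (xy_mem_of_le hx' (by omega) (by omega))), smul_mem_iff_of_ne_zero hn'] at h1
    rw [binomialIdeal, Ideal.span_le]
    simp only [Set.insert_subset_iff, Set.singleton_subset_iff, SetLike.mem_coe, zero_smul,
      add_zero]
    exact ⟨hx', hy', xy_mem_of_le hx' (by omega) (by omega),
      xy_mem_of_le hy' (by omega) (by omega)⟩

/-! ### Finiteness and values of the Tjurina number. -/

theorem tjurina_curvePoly_of_le {a b c : ℕ} (ha : 2 ≤ a) (hb : a ≤ b) (h : a < b + c) :
    Module.Finite ℂ (TjurinaAlgebra (curvePoly a b c) 0) ∧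
      tjurinaNumber (curvePoly a b c) 0 = (a - 1) * (a - 1) := by
  obtain ⟨n, rfl⟩ : ∃ n, a = n + 1 := ⟨a - 1, by omega⟩
  have := finite_quotient_binomialIdeal (n := n) (β := n - 1) (γ := n - 1) (p := 0) (q := 0)
    (by omega) le_rfl (by simp)
  have h1 := finrank_quotient_binomialIdeal (n := n) (β := n - 1) (γ := n - 1) (p := 0) (q := 0)
    (by omega) le_rfl (by simp)
  have h2 := finite_tjurinaAlgebra_and_tjurinaNumber_eq
    (pointIdeal_zero_le_radical_binomialIdeal _ _ _ _ _)
    (map_jacobianIdeal_curvePoly_of_lt (n := n) (b := b) (c := c) (by omega) (by omega) h)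
  refine ⟨h2.1, ?_⟩
  rw [h2.2, Nat.add_sub_cancel, ← h1, Nat.sub_add_cancel (by omega)]
  rw [show n - (2 * (n - 1) + 2) = 0 by omega]
  simp

theorem tjurina_curvePoly_of_lt {a b c : ℕ} (hb : b < a) (hc : c ≤ b) (h : a < b + c) :
    Module.Finite ℂ (TjurinaAlgebra (curvePoly a b c) 0) ∧
      tjurinaNumber (curvePoly a b c) 0 + (a - 1 - b) * (a - 1 - c) + (a - 1 - 2 * c) =
        (a - 1) * (a - 1) := by
  obtain ⟨n, rfl⟩ : ∃ n, a = n + 1 := ⟨a - 1, by omega⟩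
  obtain ⟨β, rfl⟩ : ∃ β, b = β + 1 := ⟨b - 1, by omega⟩
  obtain ⟨γ, rfl⟩ : ∃ γ, c = γ + 1 := ⟨c - 1, by omega⟩
  -- The first alternative holds: n < β + γ + 1 ≤ 2β + 1.
  have h2 : n ≤ 2 * β ∨ ((β + 1 : ℂ) / (n + 1) = 0 ∧ (γ + 1 : ℂ) / (n + 1) = 0) := by omega
  have := finite_quotient_binomialIdeal (by omega) (by omega : γ ≤ β) h2
  have h1 := finrank_quotient_binomialIdeal (by omega) (by omega : γ ≤ β) h2
  have h3 := finite_tjurinaAlgebra_and_tjurinaNumber_eq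
    (pointIdeal_zero_le_radical_binomialIdeal _ _ _ _ _)
    (congrArg (Ideal.map (algebraMap _ (LocalRingAt 0)))
      (jacobianIdeal_curvePoly_eq_binomialIdeal (n := n) (β := β) (γ := γ)
        (by omega) (by omega)))
  refine ⟨h3.1, ?_⟩
  rw [h3.2]
  exact h1

theorem finite_tjurinaAlgebra_curvePoly {a b c : ℕ} (ha : 2 ≤ a) (h : a < b + c) :
    Module.Finite ℂ (TjurinaAlgebra (curvePoly a b c) 0) := by
  wlog hc : c ≤ b generalizing b c
  · exact finite_tjurinaAlgebra_curvePoly_comm (this (by omega) (by omega))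
  rcases le_or_gt a b with hb | hb
  · exact (tjurina_curvePoly_of_le ha hb h).1
  · exact (tjurina_curvePoly_of_lt hb hc h).1

/-! ### The ordinary singularity -/

theorem isHomogeneous_xy (i j : ℕ) : (xy i j).IsHomogeneous (i + j) :=
  (isHomogeneous_X_pow _ _).mul (isHomogeneous_X_pow _ _)

theorem xy_mem_pow_pointIdeal {i j m : ℕ} (h : m ≤ i + j) : xy i j ∈ pointIdeal 0 ^ m := by
  rw [pointIdeal_zero, xy_eq_monomial, monomial_mem_pow_idealOfVars_iff _ _ one_ne_zero]
  simpa using h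

/-- With w^a = -1 the form is x^a - (w y)^a, the product of x - ζ w y over the a-th roots of unity
ζ. -/
theorem exists_tangent_lines {a : ℕ} (ha : 0 < a) : ∃ u v : Fin a → ℂ,
    (∀ i j, i ≠ j → u i * v j ≠ u j * v i) ∧
      xy a 0 + xy 0 a = ∏ i, (C (u i) * X 0 + C (v i) * X 1) := by
  obtain ⟨w, hw⟩ := IsAlgClosed.exists_pow_nat_eq (-1 : ℂ) ha
  have hw0 : w ≠ 0 := by
    rintro rfl
    rw [zero_pow ha.ne'] at hw
    norm_num at hw
  have hζ := Complex.isPrimitiveRoot_exp a ha.ne'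
  let e : Fin a ≃ Polynomial.nthRootsFinset a (1 : ℂ) :=
    (Fintype.equivFinOfCardEq (by rw [Fintype.card_coe, hζ.card_nthRootsFinset])).symm
  refine ⟨fun _ => 1, fun i => -(w * (e i : ℂ)), fun i j hij h => hij ?_, ?_⟩
  · apply e.injective
    apply Subtype.ext
    rw [one_mul, one_mul, neg_inj] at h
    exact (mul_left_cancel₀ hw0 h).symm
  · have hC := C_injective (Fin 2) ℂ
    have h2 : (X 0 ^ a - (C w * X 1) ^ a : MvPolynomial (Fin 2) ℂ) =
        ∏ z ∈ Polynomial.nthRootsFinset a (1 : ℂ), (X 0 - C z * (C w * X 1)) := by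
      classical
      have h1 := hζ.map_of_injective hC
      -- The constants already supply a roots of unity in the polynomial ring, and there are no more
      -- than a.
      have h3 : (Polynomial.nthRootsFinset a (1 : ℂ)).image C =
          Polynomial.nthRootsFinset a (1 : MvPolynomial (Fin 2) ℂ) := by
        refine Finset.eq_of_subset_of_card_le (Finset.image_subset_iff.2 fun z hz =>
          Polynomial.map_mem_nthRootsFinset_one hz _) ?_
        rw [Finset.card_image_of_injective _ hC, hζ.card_nthRootsFinset, h1.card_nthRootsFinset]
      rw [h1.pow_sub_pow_eq_prod_sub_mul _ _ ha, ← h3, Finset.prod_image fun _ _ _ _ h => hC h]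
    rw [← Finset.prod_coe_sort, ← e.prod_comp] at h2
    rw [mul_pow, ← C_pow, hw] at h2
    simp only [xy, pow_zero, one_mul, mul_one]
    convert h2 using 1
    · simp
    · refine Finset.prod_congr rfl fun i _ => ?_
      simp only [map_neg, map_mul, map_one]
      ring

theorem isOrdinarySingularity_curvePoly {a b c : ℕ} (ha : 2 ≤ a) (h : a < b + c) :
    IsOrdinarySingularity (curvePoly a b c) 0 a where
  two_le := ha
  mem_pow := by
    rw [curvePoly_eq_xy]
    exact Ideal.add_mem _ (Ideal.add_mem _ (xy_mem_pow_pointIdeal (by omega))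
      (xy_mem_pow_pointIdeal (by omega))) (xy_mem_pow_pointIdeal (by omega))
  notMem_pow_succ := by
    intro h'
    rw [pointIdeal_zero, mem_pow_idealOfVars_iff'] at h'
    have h1 := h' (Finsupp.single 0 a) (by simp)
    simp only [curvePoly_eq_xy, xy_eq_monomial, coeff_add, coeff_monomial, Finsupp.ext_iff,
      Fin.forall_fin_two] at h1
    rw [if_pos (by simp), if_neg (by simp; omega), if_neg (by simp; omega)] at h1
    simp at h1
  tangentCone := by
    have h1 : taylorForm (curvePoly a b c) 0 a = xy a 0 + xy 0 a := by
      have h2 : aeval (fun i => X i + C ((0 : Fin 2 → ℂ) i)) (curvePoly a b c) =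
          curvePoly a b c := by
        simp [curvePoly]
      rw [taylorForm, h2, curvePoly_eq_xy, map_add, map_add,
        homogeneousComponent_of_mem (isHomogeneous_xy a 0),
        homogeneousComponent_of_mem (isHomogeneous_xy 0 a),
        homogeneousComponent_of_mem (isHomogeneous_xy b c)]
      simp [h.ne]
    rw [h1]
    exact exists_tangent_lines (by omega)

/-! ### Closed formulas and the minimum. -/

/-- For b < a the cases are split by whether the truncated term a - 1 - 2c vanishes. The finer
division in the main theorem follows: b = a - 1 turns the last formula into (a - 1)², and c = a/2
lets it be rewritten. -/
theorem tjurinaNumber_curvePoly_cases {a b c : ℕ} (ha : 2 ≤ a) (h : a < b + c) (hc : c ≤ b) :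
    (a ≤ b ∧ (tjurinaNumber (curvePoly a b c) 0 : ℤ) = ((a : ℤ) - 1) ^ 2) ∨
    (b < a ∧ 2 * c < a ∧ (tjurinaNumber (curvePoly a b c) 0 : ℤ) =
      (b : ℤ) * (a - 1) + c * (a + 1) - b * c - a + 1) ∨
    (b < a ∧ a ≤ 2 * c ∧ (tjurinaNumber (curvePoly a b c) 0 : ℤ) =
      (b : ℤ) * (a - 1) + c * (a - 1) - b * c) := by
  rcases le_or_gt a b with hb | hb
  · left
    rw [(tjurina_curvePoly_of_le ha hb h).2]
    push_cast [Nat.cast_sub (by omega : 1 ≤ a)]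
    exact ⟨hb, by ring⟩
  · right
    have h1 := (tjurina_curvePoly_of_lt hb hc h).2
    obtain ⟨n, rfl⟩ : ∃ n, a = n + 1 := ⟨a - 1, by omega⟩
    obtain ⟨u, rfl⟩ : ∃ u, n = b + u := ⟨n - b, by omega⟩
    obtain ⟨v, rfl⟩ : ∃ v, b = c + v := ⟨b - c, by omega⟩
    rw [show c + v + u + 1 - 1 - (c + v) = u by omega,
      show c + v + u + 1 - 1 - c = v + u by omega, Nat.add_sub_cancel] at h1
    rcases lt_or_ge (c + v + u) (2 * c) with h2 | h2
    · right
      rw [Nat.sub_eq_zero_of_le h2.le] at h1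
      refine ⟨hb, by omega, ?_⟩
      zify at h1
      push_cast
      linear_combination h1
    · left
      zify [h2] at h1
      refine ⟨hb, by omega, ?_⟩
      push_cast
      linear_combination h1

theorem floor_quarter_cases (a : ℕ) :
    (Even a ∧ 4 * ⌊(3 * (a : ℚ) ^ 2 - 2 * a - 4) / 4⌋ = 3 * (a : ℤ) ^ 2 - 2 * a - 4) ∨
    (Odd a ∧ 4 * ⌊(3 * (a : ℚ) ^ 2 - 2 * a - 4) / 4⌋ = 3 * (a : ℤ) ^ 2 - 2 * a - 5) := by
  rcases Nat.even_or_odd a with ha | ha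
  · left
    refine ⟨ha, ?_⟩
    obtain ⟨k, rfl⟩ := ha
    have : ⌊(3 * ((k + k : ℕ) : ℚ) ^ 2 - 2 * (k + k : ℕ) - 4) / 4⌋ = 3 * (k : ℤ) ^ 2 - k - 1 := by
      rw [Int.floor_eq_iff]
      push_cast
      constructor <;> linarith
    rw [this]
    push_cast
    ring
  · right
    refine ⟨ha, ?_⟩
    obtain ⟨k, rfl⟩ := ha
    have : ⌊(3 * ((2 * k + 1 : ℕ) : ℚ) ^ 2 - 2 * (2 * k + 1 : ℕ) - 4) / 4⌋ =
        3 * (k : ℤ) ^ 2 + 2 * k - 1 := by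
      rw [Int.floor_eq_iff]
      push_cast
      constructor <;> linarith
    rw [this]
    push_cast
    ring

theorem floor_le_tjurinaNumber_curvePoly {a b c : ℕ} (ha : 2 ≤ a) (h : a < b + c) (hc : c ≤ b) :
    ⌊(3 * (a : ℚ) ^ 2 - 2 * a - 4) / 4⌋ ≤ tjurinaNumber (curvePoly a b c) 0 ∧
    ((tjurinaNumber (curvePoly a b c) 0 : ℤ) = ⌊(3 * (a : ℚ) ^ 2 - 2 * a - 4) / 4⌋ ↔
      a ≤ 4 ∨ (Even a ∧ 2 * b = a + 2 ∧ 2 * c = a) ∨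
        (Odd a ∧ 2 * b = a + 1 ∧ 2 * c = a + 1)) := by
  have hT := tjurinaNumber_curvePoly_cases ha h hc
  have hM := floor_quarter_cases a
  generalize (tjurinaNumber (curvePoly a b c) 0 : ℤ) = T at hT ⊢
  generalize ⌊(3 * (a : ℚ) ^ 2 - 2 * a - 4) / 4⌋ = M at hM ⊢
  rcases le_or_gt a 4 with h4 | h4
  · suffices T = M from ⟨this.ge, fun _ => Or.inl h4, fun _ => this⟩
    -- For a ≤ 4 every admissible pair gives (a - 1)², which equals the floor.
    have hab : a = 2 ∧ a ≤ b ∨ a = 3 ∧ (a ≤ b ∨ b = 2 ∧ c = 2) ∨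
        a = 4 ∧ (a ≤ b ∨ b = 3 ∧ c = 2 ∨ b = 3 ∧ c = 3) := by omega
    rcases hab with ⟨rfl, hb⟩ | ⟨rfl, hb | ⟨rfl, rfl⟩⟩ | ⟨rfl, hb | ⟨rfl, rfl⟩ | ⟨rfl, rfl⟩⟩ <;>
      norm_num [Nat.even_iff, Nat.odd_iff] at hT hM <;> omega
  rw [or_iff_right h4.not_ge]
  rcases hT with ⟨hb, hT⟩ | ⟨hb, hca, hT⟩ | ⟨hb, hca, hT⟩
  -- Here 4(T - M) is (a - 2)(a - 4) for a even and one more for a odd.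
  · have hlt : M < T := by
      zify at h4
      rcases hM with ⟨-, hM⟩ | ⟨-, hM⟩ <;> nlinarith
    exact ⟨hlt.le, fun h' => absurd h' hlt.ne', by omega⟩
  · obtain ⟨u, rfl⟩ : ∃ u, a = b + 1 + u := ⟨a - 1 - b, by omega⟩
    obtain ⟨d, rfl⟩ : ∃ d, b = c + d := ⟨b - c, by omega⟩
    obtain ⟨s, rfl⟩ : ∃ s, c = u + 2 + s := ⟨c - u - 2, by omega⟩
    -- Here 4(T - M) = (d - 2)² + s² + 4s + 2s(2u + d) + 4, less 1 when a is even, so it is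
    -- positive.
    have hlt : M < T := by
      push_cast at hT hM
      rcases hM with ⟨-, hM⟩ | ⟨-, hM⟩ <;>
        nlinarith [sq_nonneg ((d : ℤ) - 2), mul_nonneg (Int.natCast_nonneg s)
          (Int.natCast_nonneg u), mul_nonneg (Int.natCast_nonneg s) (Int.natCast_nonneg d),
          sq_nonneg (s : ℤ)]
    exact ⟨hlt.le, fun h' => absurd h' hlt.ne', by omega⟩
  · obtain ⟨u, rfl⟩ : ∃ u, a = b + 1 + u := ⟨a - 1 - b, by omega⟩
    obtain ⟨d, rfl⟩ : ∃ d, b = c + d := ⟨b - c, by omega⟩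
    obtain ⟨s, rfl⟩ : ∃ s, c = u + 2 + s := ⟨c - u - 2, by omega⟩
    have hsum : 4 * (T - M) = d ^ 2 + s ^ 2 + 2 * s * (2 * u + d) - 1 ∧
          Even (u + 2 + s + d + 1 + u) ∨
        4 * (T - M) = d ^ 2 + s ^ 2 + 2 * s * (2 * u + d) ∧
          Odd (u + 2 + s + d + 1 + u) := by
      push_cast at hT hM
      rcases hM with ⟨h', hM⟩ | ⟨h', hM⟩
      · exact Or.inl ⟨by rw [mul_sub, hM, hT]; ring, h'⟩
      · exact Or.inr ⟨by rw [mul_sub, hM, hT]; ring, h'⟩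
    have h0 : (0 : ℤ) ≤ 2 * s * (2 * u + d) := by positivity
    rcases hsum with ⟨hs, he⟩ | ⟨hs, ho⟩
    -- As a = 2u + s + d + 3 is even, s + d is odd, which absorbs the -1. Equality forces d = 1, s =
    -- 0, except for the case u = d = 0, s = 1.
    · have hodd : s + d ≠ 0 := by
        rintro h'
        rw [Nat.even_iff] at he
        omega
      refine ⟨?_, fun h' => Or.inl ⟨he, ?_⟩, ?_⟩
      · rcases (by omega : 1 ≤ d ∨ 1 ≤ s) with h1 | h1 <;> zify at h1 <;>
          nlinarith [sq_nonneg (d : ℤ), sq_nonneg (s : ℤ)]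
      · rcases Nat.eq_zero_or_pos s with rfl | h1
        · have hd : (d : ℤ) ^ 2 = 1 := by
            rw [h', sub_self] at hs
            norm_num at hs
            linarith
          have hd' : d ^ 2 = 1 := by exact_mod_cast hd
          rw [Nat.pow_eq_one] at hd'
          omega
        -- The exceptional case u = d = 0, s = 1 is (a, b, c) = (4, 3, 3), excluded by a > 4.
        · have h3 : 1 ≤ 2 * u + d := by
            by_contra h3
            obtain ⟨rfl, rfl⟩ : u = 0 ∧ d = 0 := by omega
            have h4' : 2 ≤ s := by omega
            zify at h4'
            norm_num at hs
            nlinarith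
          zify at h1 h3
          nlinarith [sq_nonneg (d : ℤ), mul_le_mul h1 h3 zero_le_one (by positivity)]
      · rintro (⟨-, h1, h2⟩ | ⟨ho, -⟩)
        · obtain ⟨rfl, rfl⟩ : d = 1 ∧ s = 0 := by omega
          norm_num at hs
          omega
        · exact absurd he (Nat.not_even_iff_odd.2 ho)
    · refine ⟨by nlinarith [sq_nonneg (d : ℤ), sq_nonneg (s : ℤ)], fun h' => Or.inr ⟨ho, ?_⟩, ?_⟩
      · have hd : (d : ℤ) ^ 2 = 0 := by nlinarith [sq_nonneg (d : ℤ), sq_nonneg (s : ℤ)]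
        have hs' : (s : ℤ) ^ 2 = 0 := by nlinarith [sq_nonneg (d : ℤ), sq_nonneg (s : ℤ)]
        rw [sq_eq_zero_iff, Nat.cast_eq_zero] at hd hs'
        omega
      · rintro (⟨he, -⟩ | ⟨-, h1, h2⟩)
        · exact absurd he (Nat.not_even_iff_odd.2 ho)
        · obtain ⟨rfl, rfl⟩ : d = 0 ∧ s = 0 := by omega
          norm_num at hs
          omega

/-! ### Assembly of the main theorem. -/

theorem mainTheorem1 (a : ℕ) (ha : 2 ≤ a) :
    -- the origin is an ordinary `a`-fold point, and the Tjurina number there is finite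
    (∀ b c : ℕ, a < b + c →
      IsOrdinarySingularity (curvePoly a b c) 0 a ∧
      Module.Finite ℂ (TjurinaAlgebra (curvePoly a b c) 0)) ∧
    -- the values of the Tjurina number for `b ≥ c`; the four cases exhaust all possibilities
    (∀ b c : ℕ, a < b + c → c ≤ b →
      ((a ≤ b ∨ ((b : ℚ) = a - 1 ∧ (a : ℚ) / 2 ≤ c)) →
        (tjurinaNumber (curvePoly a b c) 0 : ℤ) = ((a : ℤ) - 1) ^ 2) ∧
      ((((a : ℚ) + 1) / 2 < b ∧ (b : ℚ) ≤ a - 1 ∧ (c : ℚ) ≤ ((a : ℚ) - 1) / 2) →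
        (tjurinaNumber (curvePoly a b c) 0 : ℤ) =
          (b : ℤ) * (a - 1) + c * (a + 1) - b * c - a + 1) ∧
      ((((a : ℚ) + 1) / 2 < b ∧ (b : ℚ) < a - 1 ∧ (c : ℚ) = (a : ℚ) / 2) →
        (tjurinaNumber (curvePoly a b c) 0 : ℤ) =
          (b : ℤ) * (a - 1) + c * (a + 1) - b * c - a) ∧
      ((((a : ℚ) + 1) / 2 ≤ b ∧ (b : ℚ) < a - 1 ∧ ((a : ℚ) + 1) / 2 ≤ c ∧ (c : ℚ) < a - 1) →
        (tjurinaNumber (curvePoly a b c) 0 : ℤ) =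
          (b : ℤ) * (a - 1) + c * (a - 1) - b * c) ∧
      ((a ≤ b ∨ ((b : ℚ) = a - 1 ∧ (a : ℚ) / 2 ≤ c)) ∨
        (((a : ℚ) + 1) / 2 < b ∧ (b : ℚ) ≤ a - 1 ∧ (c : ℚ) ≤ ((a : ℚ) - 1) / 2) ∨
        (((a : ℚ) + 1) / 2 < b ∧ (b : ℚ) < a - 1 ∧ (c : ℚ) = (a : ℚ) / 2) ∨
        (((a : ℚ) + 1) / 2 ≤ b ∧ (b : ℚ) < a - 1 ∧ ((a : ℚ) + 1) / 2 ≤ c ∧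
          (c : ℚ) < a - 1))) ∧
    -- the minimum over all `b`, `c` with `b + c > a`
    IsLeast {t : ℤ | ∃ b c : ℕ, a < b + c ∧ t = tjurinaNumber (curvePoly a b c) 0}
      ⌊(3 * (a : ℚ) ^ 2 - 2 * a - 4) / 4⌋ ∧
    -- the exponents `b ≥ c` at which the minimum is attained
    (∀ b c : ℕ, a < b + c → c ≤ b →
      ((Even a ∧ (b : ℚ) = (a : ℚ) / 2 + 1 ∧ (c : ℚ) = (a : ℚ) / 2) ∨
        (Odd a ∧ (b : ℚ) = ((a : ℚ) + 1) / 2 ∧ (c : ℚ) = ((a : ℚ) + 1) / 2) →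
        (tjurinaNumber (curvePoly a b c) 0 : ℤ) = ⌊(3 * (a : ℚ) ^ 2 - 2 * a - 4) / 4⌋) ∧
      (5 ≤ a →
        (tjurinaNumber (curvePoly a b c) 0 : ℤ) = ⌊(3 * (a : ℚ) ^ 2 - 2 * a - 4) / 4⌋ →
        (Even a ∧ (b : ℚ) = (a : ℚ) / 2 + 1 ∧ (c : ℚ) = (a : ℚ) / 2) ∨
        (Odd a ∧ (b : ℚ) = ((a : ℚ) + 1) / 2 ∧ (c : ℚ) = ((a : ℚ) + 1) / 2)) ∧
      (a ≤ 4 →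
        (tjurinaNumber (curvePoly a b c) 0 : ℤ) =
          ⌊(3 * (a : ℚ) ^ 2 - 2 * a - 4) / 4⌋)) := by

  refine ⟨fun b c h => ⟨isOrdinarySingularity_curvePoly ha h, finite_tjurinaAlgebra_curvePoly ha h⟩,
    fun b c h hc => ?_, ⟨?_, ?_⟩, fun b c h hc => ?_⟩
  · have e1 : (b : ℚ) = a - 1 ↔ b + 1 = a := by
      rw [eq_sub_iff_add_eq]
      exact_mod_cast Iff.rfl
    have e2 : (a : ℚ) / 2 ≤ c ↔ a ≤ c * 2 := by
      rw [div_le_iff₀ two_pos]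
      exact_mod_cast Iff.rfl
    have e3 : ((a : ℚ) + 1) / 2 < b ↔ a + 1 < b * 2 := by
      rw [div_lt_iff₀ two_pos]
      exact_mod_cast Iff.rfl
    have e4 : (b : ℚ) ≤ a - 1 ↔ b + 1 ≤ a := by
      rw [le_sub_iff_add_le]
      exact_mod_cast Iff.rfl
    have e5 : (c : ℚ) ≤ ((a : ℚ) - 1) / 2 ↔ c * 2 + 1 ≤ a := by
      rw [le_div_iff₀ two_pos, le_sub_iff_add_le]
      exact_mod_cast Iff.rfl
    have e6 : ∀ x : ℕ, (x : ℚ) < a - 1 ↔ x + 1 < a := by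
      intro x
      rw [lt_sub_iff_add_lt]
      exact_mod_cast Iff.rfl
    have e7 : (c : ℚ) = (a : ℚ) / 2 ↔ c * 2 = a := by
      rw [eq_div_iff two_ne_zero]
      exact_mod_cast Iff.rfl
    have e8 : ∀ x : ℕ, ((a : ℚ) + 1) / 2 ≤ x ↔ a + 1 ≤ x * 2 := by
      intro x
      rw [div_le_iff₀ two_pos]
      exact_mod_cast Iff.rfl
    rw [e1, e2, e3, e4, e5, e6, e6, e7, e8, e8]
    have hT := tjurinaNumber_curvePoly_cases ha h hc
    refine ⟨fun h' => ?_, fun h' => ?_, fun h' => ?_, fun h' => ?_, by omega⟩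
    · rcases hT with hT | hT | hT
      · exact hT.2
      · omega
      · obtain rfl : a = b + 1 := by omega
        rw [hT.2.2]
        push_cast
        ring
    · rcases hT with hT | hT | hT
      · omega
      · exact hT.2.2
      · omega
    · rcases hT with hT | hT | hT
      · omega
      · omega
      · obtain rfl : a = c * 2 := by omega
        rw [hT.2.2]
        push_cast
        ring
    · rcases hT with hT | hT | hT
      · omega
      · omega
      · exact hT.2.2
  · rcases Nat.even_or_odd a with h' | h'
    · obtain ⟨k, hk⟩ := id h'
      exact ⟨k + 1, k, by omega, ((floor_le_tjurinaNumber_curvePoly ha (by omega)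
        (by omega)).2.2 (Or.inr (Or.inl ⟨h', by omega, by omega⟩))).symm⟩
    · obtain ⟨k, hk⟩ := id h'
      exact ⟨k + 1, k + 1, by omega, ((floor_le_tjurinaNumber_curvePoly ha (by omega)
        le_rfl).2.2 (Or.inr (Or.inr ⟨h', by omega, by omega⟩))).symm⟩
  · rintro t ⟨b, c, h, rfl⟩
    rcases le_total c b with hc | hc
    · exact (floor_le_tjurinaNumber_curvePoly ha h hc).1
    · rw [tjurinaNumber_curvePoly_comm]
      exact (floor_le_tjurinaNumber_curvePoly ha (by omega) hc).1
  · have e1 : (b : ℚ) = (a : ℚ) / 2 + 1 ↔ 2 * b = a + 2 := by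
      rw [← @Nat.cast_inj ℚ]
      push_cast
      constructor <;> intro h <;> linarith
    have e2 : (c : ℚ) = (a : ℚ) / 2 ↔ 2 * c = a := by
      rw [← @Nat.cast_inj ℚ]
      push_cast
      constructor <;> intro h <;> linarith
    have e3 : ∀ x : ℕ, (x : ℚ) = ((a : ℚ) + 1) / 2 ↔ 2 * x = a + 1 := by
      intro x
      rw [← @Nat.cast_inj ℚ]
      push_cast
      constructor <;> intro h <;> linarith
    rw [e1, e2, e3, e3, (floor_le_tjurinaNumber_curvePoly ha h hc).2]
    exact ⟨Or.inr, fun h5 h' => h'.resolve_left (by omega), Or.inl⟩
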